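/- A convex quadrilateral $Q$ is called a midpoint diagonal quadrilateral if the intersection point of its diagonals is the midpoint of at least one of the diagonals. An ellipse (circles included) is inscribed in $Q$ if it lies inside $Q$ and is tangent to each of the four sides of $Q$. A diameter of an ellipse is a chord through its center; two diameters $l$ and $m$ are conjugate if the midpoints of all chords parallel to $l$ lie on $m$, and they are equal conjugate diameters if, in addition, they have the same length. Parallel lines are allowed to coincide. Theorem. Let $Q$ be a midpoint diagonal quadrilateral. (i) Among all ellipses inscribed in $Q$ there is a unique one, $E_I$, of minimal eccentricity. (ii) There is a unique pair of conjugate diameters of $E_I$ that are parallel to the diagonals of $Q$, one to each, and these two diameters are equal conjugate diameters of $E_I$. -/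

import Mathlib

open scoped Affine

/-- The Euclidean plane. -/
abbrev Plane : Type := EuclideanSpace ℝ (Fin 2)

/-- `E` is the ellipse with center `c`, semi-major axis `a` and semi-minor axis `b`, its axes
pointing along some orthonormal basis of the plane. Circles (`a = b`) are included. -/
def IsEllipseWith (E : Set Plane) (c : Plane) (a b : ℝ) : Prop :=
  0 < b ∧ b ≤ a ∧ ∃ f : OrthonormalBasis (Fin 2) ℝ Plane,
    E = {P | (inner ℝ (f 0) (P - c)) ^ 2 / a ^ 2 + (inner ℝ (f 1) (P - c)) ^ 2 / b ^ 2 = 1}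

/-- `E` is an ellipse. -/
def IsEllipse (E : Set Plane) : Prop :=
  ∃ c a b, IsEllipseWith E c a b

/-- `E` is an ellipse with center `c`. -/
def HasCenter (E : Set Plane) (c : Plane) : Prop :=
  ∃ a b, IsEllipseWith E c a b

/-- `E` is an ellipse with eccentricity `e`. -/
def HasEccentricity (E : Set Plane) (e : ℝ) : Prop :=
  ∃ c a b, IsEllipseWith E c a b ∧ e = Real.sqrt (1 - b ^ 2 / a ^ 2)

/-- The points `A 0`, `A 1`, `A 2`, `A 3` are, in this cyclic order, the vertices of a
(nondegenerate) convex quadrilateral: no three of them are collinear and the two diagonals,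
as segments, meet. -/
def IsConvexQuadrilateral (A : Fin 4 → Plane) : Prop :=
  (∀ i j k : Fin 4, i ≠ j → j ≠ k → i ≠ k → ¬ Collinear ℝ {A i, A j, A k}) ∧
    (segment ℝ (A 0) (A 2) ∩ segment ℝ (A 1) (A 3)).Nonempty

/-- A convex quadrilateral whose diagonals intersect at the midpoint of at least one of them. -/
def IsMidpointDiagonalQuadrilateral (A : Fin 4 → Plane) : Prop :=
  IsConvexQuadrilateral A ∧
    ∃ P ∈ segment ℝ (A 0) (A 2) ∩ segment ℝ (A 1) (A 3),
      P = midpoint ℝ (A 0) (A 2) ∨ P = midpoint ℝ (A 1) (A 3)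

/-- The ellipse `E` is tangent to the side `XY`: the line `XY` meets `E` in exactly one point
(that is, it is a tangent line of `E`), and this point belongs to the side. -/
def IsTangentToSide (E : Set Plane) (X Y : Plane) : Prop :=
  ∃ P ∈ segment ℝ X Y, E ∩ (line[ℝ, X, Y] : Set Plane) = {P}

/-- `E` is an ellipse inscribed in the quadrilateral: it lies inside it and is tangent to each of
its four sides. (The index `i + 1` is taken modulo `4`.) -/
def IsInscribed (E : Set Plane) (A : Fin 4 → Plane) : Prop :=
  IsEllipse E ∧ E ⊆ convexHull ℝ (Set.range A) ∧ ∀ i : Fin 4, IsTangentToSide E (A i) (A (i + 1))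

/-- `E` is an ellipse inscribed in the quadrilateral, and its eccentricity is minimal among all
ellipses inscribed in the quadrilateral. -/
def IsMinimalEccentricityInscribed (E : Set Plane) (A : Fin 4 → Plane) : Prop :=
  IsInscribed E A ∧
    ∀ E', IsInscribed E' A → ∀ e e', HasEccentricity E e → HasEccentricity E' e' → e ≤ e'

/-- `l` is a diameter of the ellipse `E`: a chord of `E` through the center, hence bisected by the
center. -/
def IsDiameter (E l : Set Plane) : Prop :=
  ∃ c P P', HasCenter E c ∧ P ∈ E ∧ P' ∈ E ∧ midpoint ℝ P P' = c ∧ l = segment ℝ P P'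

/-- `l` and `m` are conjugate diameters of `E`: the midpoints of all chords of `E` parallel to `l`
lie on `m`. -/
def AreConjugateDiameters (E l m : Set Plane) : Prop :=
  IsDiameter E l ∧ IsDiameter E m ∧
    ∀ X ∈ E, ∀ Y ∈ E, X ≠ Y → line[ℝ, X, Y] ∥ affineSpan ℝ l → midpoint ℝ X Y ∈ m

/-- `l` and `m` are conjugate diameters of `E` of equal length. (The length of a segment is its
metric diameter.) -/
def AreEqualConjugateDiameters (E l m : Set Plane) : Prop :=
  AreConjugateDiameters E l m ∧ Metric.diam l = Metric.diam m

/-- `l` and `m` are conjugate diameters of `E` that are parallel to the two diagonals of the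
quadrilateral; the pair is listed in the order of the diagonals `A 0 A 2` and `A 1 A 3`. -/
def AreConjugateDiametersParallelToDiagonals (E : Set Plane) (A : Fin 4 → Plane)
    (l m : Set Plane) : Prop :=
  AreConjugateDiameters E l m ∧
    affineSpan ℝ l ∥ line[ℝ, A 0, A 2] ∧ affineSpan ℝ m ∥ line[ℝ, A 1, A 3]

/-!
Suppose the diagonal `A 0 A 2` is bisected by the other one (otherwise shift the labels). Taking the
intersection of the diagonals as origin and vectors `u`, `v` along the diagonals, the vertices
have coordinates `(-1, 0)`, `(0, p)`, `(1, 0)`, `(0, -q)` with `p, q > 0`: an affine kite.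

Writing out the four tangency conditions for an arbitrary ellipse, one finds that the mixed term
and the abscissa of the center vanish, so the inscribed ellipses are exactly
`x ^ 2 / t + (y - k) ^ 2 / g = 1`, `0 < t < 1`, where `k = (p - q) (1 - t) / 2` and
`g = (1 - t) ((p + q) ^ 2 - (p - q) ^ 2 t) / 4` (`IsKite.of_isInscribed`, `IsKite.isInscribed`).
Hence the diameters parallel to the diagonals are conjugate for every inscribed ellipse, with squared
half-lengths `t ‖u‖ ^ 2` and `g ‖v‖ ^ 2`.

By Apollonius' relations the semi-axes satisfy `a ^ 2 + b ^ 2 = t ‖u‖ ^ 2 + g ‖v‖ ^ 2`, while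
`a ^ 2 b ^ 2` is `t g` times the Gram determinant of `u`, `v`. The eccentricity is an increasing
function of `(a ^ 2 + b ^ 2) ^ 2 / (a ^ 2 b ^ 2)`, so by the arithmetic–geometric mean inequality it
is minimal exactly when `t ‖u‖ ^ 2 = g ‖v‖ ^ 2`, that is, when the two conjugate diameters are equal.
Since `g` decreases from a positive value to `0` as `t` runs over `[0, 1]`, there is
exactly one such `t` (`IsKite.exists_minimal`). That this member of the family is an ellipse in the
sense of the definition is seen directly: its axes are the bisectors of its equal conjugate diameters
(`isEllipseWith_obliqueCircle_of_inner_nonneg`).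

Finally, the center of an ellipse is determined by its points (`HasCenter.eq_of_obliqueCircle`), so a
diameter is determined by its direction (`IsDiameter.eq_segment`); this gives the uniqueness of the
pair of diameters.
-/

/-! ### Oblique coordinates in the plane -/

theorem pair_coords {u v : Plane} (h : LinearIndependent ℝ ![u, v]) (x : Plane) :
    ∃ α β : ℝ, x = α • u + β • v := by
  let B := basisOfLinearIndependentOfCardEqFinrank h (by simp)
  refine ⟨B.repr x 0, B.repr x 1, ?_⟩
  have := B.sum_repr x
  simpa [Fin.sum_univ_two, B] using this.symm

theorem pair_coords_inj {u v : Plane} (h : LinearIndependent ℝ ![u, v]) {α β α' β' : ℝ}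
    (e : α • u + β • v = α' • u + β' • v) : α = α' ∧ β = β' := by
  have := LinearIndependent.pair_iff.1 h (α - α') (β - β') (by
    rw [sub_smul, sub_smul, ← sub_eq_zero.2 e]; abel)
  exact ⟨sub_eq_zero.1 this.1, sub_eq_zero.1 this.2⟩

/-! ### Tangency and the equation of an ellipse in oblique coordinates -/

/-- If the points of `E` on the line `XY` are the roots of a quadratic in the affine parameter, then
tangency to the side `XY` means that the quadratic has a double root and that it lies in `[0, 1]`. -/
theorem isTangentToSide_iff {E : Set Plane} {X Y : Plane} {k m n : ℝ} (hXY : X ≠ Y) (hk : 0 < k)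
    (hE : ∀ s : ℝ, AffineMap.lineMap X Y s ∈ E ↔ k * s ^ 2 + 2 * m * s + n = 1) :
    IsTangentToSide E X Y ↔
      ∃ s ∈ Set.Icc (0 : ℝ) 1, k * s + m = 0 ∧ k * s ^ 2 + 2 * m * s + n = 1 := by
  constructor
  · rintro ⟨P, hP, hs⟩
    rw [segment_eq_image_lineMap] at hP
    obtain ⟨s, hs01, rfl⟩ := hP
    have h1 : AffineMap.lineMap X Y s ∈ E ∩ (line[ℝ, X, Y] : Set Plane) := by rw [hs]; rfl
    have h2 := (hE s).1 h1.1
    refine ⟨s, hs01, ?_, h2⟩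
    -- the second root of the quadratic has to coincide with `s`
    have h3 : AffineMap.lineMap X Y (-2 * m / k - s) ∈ E ∩ (line[ℝ, X, Y] : Set Plane) := by
      refine ⟨(hE _).2 ?_, AffineMap.lineMap_mem_affineSpan_pair _ _ _⟩
      rw [← h2]; field_simp; ring
    rw [hs] at h3
    have h4 := AffineMap.lineMap_injective ℝ hXY h3
    field_simp at h4
    linarith
  · rintro ⟨s, hs01, h1, h2⟩
    refine ⟨AffineMap.lineMap X Y s, ?_, ?_⟩
    · rw [segment_eq_image_lineMap]; exact ⟨s, hs01, rfl⟩
    · ext Q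
      constructor
      · rintro ⟨hQ, hl⟩
        obtain ⟨r, rfl⟩ := (mem_affineSpan_pair_iff_exists_lineMap_eq (k := ℝ)).1 hl
        have h3 := (hE r).1 hQ
        have : k * (r - s) ^ 2 = 0 := by linear_combination h3 - h2 - 2 * (r - s) * h1
        have : r - s = 0 := by simpa [hk.ne'] using this
        rw [sub_eq_zero.1 this]; rfl
      · rintro rfl
        exact ⟨(hE s).2 h2, AffineMap.lineMap_mem_affineSpan_pair _ _ _⟩

/-- The Gram determinant of two independent vectors is positive. -/
theorem gram_pos {u v : Plane} (h : LinearIndependent ℝ ![u, v]) :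
    0 < ‖u‖ ^ 2 * ‖v‖ ^ 2 - inner ℝ u v ^ 2 := by
  have hv : v ≠ 0 := h.ne_zero 1
  have hv2 : 0 < ‖v‖ ^ 2 := by positivity
  have hne : ‖v‖ ^ 2 • u - (inner ℝ u v : ℝ) • v ≠ 0 := by
    intro e
    have := LinearIndependent.pair_iff.1 h (‖v‖ ^ 2) (-inner ℝ u v) (by
      rw [← e, neg_smul]; abel)
    exact hv2.ne' this.1
  have h1 : 0 < ‖‖v‖ ^ 2 • u - (inner ℝ u v : ℝ) • v‖ ^ 2 := by positivity
  have h2 : ‖‖v‖ ^ 2 • u - (inner ℝ u v : ℝ) • v‖ ^ 2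
      = ‖v‖ ^ 2 * (‖u‖ ^ 2 * ‖v‖ ^ 2 - inner ℝ u v ^ 2) := by
    rw [norm_sub_sq_real, norm_smul, norm_smul, inner_smul_left, inner_smul_right]
    simp only [mul_pow, norm_pow, Real.norm_eq_abs, sq_abs]
    simp
    ring
  rw [h2] at h1
  exact pos_of_mul_pos_right h1 hv2.le

/-- The equation of an ellipse in an oblique frame `(O; u, v)`, as a positive definite quadratic form
centered at the coordinates `(c₁, c₂)` of the center. The last two conclusions express the product
and the sum of the squared semi-axes through the coefficients and the Gram matrix of `(u, v)`: they
are the determinant and the trace of the inverse of the form. -/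
theorem IsEllipseWith.exists_quadratic {E : Set Plane} {c u v O : Plane} {a b c₁ c₂ : ℝ}
    (hE : IsEllipseWith E c a b) (h : LinearIndependent ℝ ![u, v])
    (hc : c = O + (c₁ • u + c₂ • v)) :
    ∃ A B C : ℝ, 0 < A ∧ 0 < C ∧ 0 < A * C - B ^ 2 ∧
      (∀ x y : ℝ, O + (x • u + y • v) ∈ E ↔
        A * (x - c₁) ^ 2 + 2 * B * (x - c₁) * (y - c₂) + C * (y - c₂) ^ 2 = 1) ∧
      a ^ 2 * b ^ 2 * (A * C - B ^ 2) = ‖u‖ ^ 2 * ‖v‖ ^ 2 - inner ℝ u v ^ 2 ∧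
      (a ^ 2 + b ^ 2) * (‖u‖ ^ 2 * ‖v‖ ^ 2 - inner ℝ u v ^ 2) =
        a ^ 2 * b ^ 2 * (A * ‖v‖ ^ 2 - 2 * B * inner ℝ u v + C * ‖u‖ ^ 2) := by
  obtain ⟨hb, hab, f, rfl⟩ := hE
  have ha : 0 < a := hb.trans_le hab
  have hG := gram_pos h
  obtain ⟨u0, hu0⟩ : ∃ z, z = inner ℝ (f 0) u := ⟨_, rfl⟩
  obtain ⟨u1, hu1⟩ : ∃ z, z = inner ℝ (f 1) u := ⟨_, rfl⟩
  obtain ⟨v0, hv0⟩ : ∃ z, z = inner ℝ (f 0) v := ⟨_, rfl⟩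
  obtain ⟨v1, hv1⟩ : ∃ z, z = inner ℝ (f 1) v := ⟨_, rfl⟩
  have hK : ‖u‖ ^ 2 = u0 ^ 2 + u1 ^ 2 := by
    rw [← f.sum_sq_inner_right u, Fin.sum_univ_two, hu0, hu1]
  have hL : ‖v‖ ^ 2 = v0 ^ 2 + v1 ^ 2 := by
    rw [← f.sum_sq_inner_right v, Fin.sum_univ_two, hv0, hv1]
  have hN : inner ℝ u v = u0 * v0 + u1 * v1 := by
    rw [← f.sum_inner_mul_inner u v, Fin.sum_univ_two, hu0, hu1, hv0, hv1,
      real_inner_comm u, real_inner_comm u]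
  rw [hK, hL, hN] at hG ⊢
  have hD : (u0 ^ 2 / a ^ 2 + u1 ^ 2 / b ^ 2) * (v0 ^ 2 / a ^ 2 + v1 ^ 2 / b ^ 2)
      - (u0 * v0 / a ^ 2 + u1 * v1 / b ^ 2) ^ 2
      = ((u0 ^ 2 + u1 ^ 2) * (v0 ^ 2 + v1 ^ 2) - (u0 * v0 + u1 * v1) ^ 2) / (a ^ 2 * b ^ 2) := by
    field_simp; ring
  have hD' : 0 < (u0 ^ 2 / a ^ 2 + u1 ^ 2 / b ^ 2) * (v0 ^ 2 / a ^ 2 + v1 ^ 2 / b ^ 2)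
      - (u0 * v0 / a ^ 2 + u1 * v1 / b ^ 2) ^ 2 := by rw [hD]; positivity
  have hA0 : 0 ≤ u0 ^ 2 / a ^ 2 + u1 ^ 2 / b ^ 2 := by positivity
  have hC0 : 0 ≤ v0 ^ 2 / a ^ 2 + v1 ^ 2 / b ^ 2 := by positivity
  have hAC : 0 < (u0 ^ 2 / a ^ 2 + u1 ^ 2 / b ^ 2) * (v0 ^ 2 / a ^ 2 + v1 ^ 2 / b ^ 2) := by
    linarith [sq_nonneg (u0 * v0 / a ^ 2 + u1 * v1 / b ^ 2)]
  refine ⟨_, u0 * v0 / a ^ 2 + u1 * v1 / b ^ 2, _, pos_of_mul_pos_left hAC hC0,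
    pos_of_mul_pos_right hAC hA0, hD', fun x y => ?_, ?_, ?_⟩
  · have e : O + (x • u + y • v) - c = (x - c₁) • u + (y - c₂) • v := by rw [hc]; module
    rw [Set.mem_ofPred_eq, e]
    simp only [inner_add_right, inner_smul_right, ← hu0, ← hu1, ← hv0, ← hv1]
    rw [← sub_eq_zero, ← sub_eq_zero (b := (1 : ℝ))]
    apply Eq.congr_left
    ring
  · rw [hD]; field_simp
  · field_simp; ring

/-! ### Ellipses given by a pair of conjugate semidiameters -/

/-- The image of the unit circle under the affine map `(α, β) ↦ c + α u + β v`. For independent `u`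
and `v` this is the ellipse with center `c` which has them as conjugate semidiameters. -/
def obliqueCircle (c u v : Plane) : Set Plane :=
  {P | ∃ α β : ℝ, α ^ 2 + β ^ 2 = 1 ∧ P = c + (α • u + β • v)}

theorem add_mem_obliqueCircle_iff {c u v : Plane} (h : LinearIndependent ℝ ![u, v]) {x y : ℝ} :
    c + (x • u + y • v) ∈ obliqueCircle c u v ↔ x ^ 2 + y ^ 2 = 1 := by
  constructor
  · rintro ⟨α, β, h1, h2⟩
    obtain ⟨rfl, rfl⟩ := pair_coords_inj h (add_left_cancel h2)
    exact h1
  · exact fun e => ⟨x, y, e, rfl⟩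

theorem obliqueCircle_neg_right (c u v : Plane) : obliqueCircle c u (-v) = obliqueCircle c u v := by
  ext P
  constructor <;>
  · rintro ⟨α, β, h1, rfl⟩
    exact ⟨α, -β, by rw [neg_sq, h1], by simp⟩

theorem obliqueCircle_swap (c u v : Plane) : obliqueCircle c u v = obliqueCircle c v u := by
  ext P
  constructor <;>
  · rintro ⟨α, β, h1, rfl⟩
    exact ⟨β, α, by rw [add_comm, h1], by rw [add_comm (α • _)]⟩

/-- When the conjugate semidiameters `u` and `v` have equal length, the axes of the ellipse point along
the bisectors `u + v` and `u - v`, which are orthogonal. The sign condition makes `u + v` the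
direction of the major axis. -/
theorem isEllipseWith_obliqueCircle_of_inner_nonneg {c u v : Plane}
    (h : LinearIndependent ℝ ![u, v]) (huv : ‖u‖ = ‖v‖) (h0 : 0 ≤ inner ℝ u v) :
    IsEllipseWith (obliqueCircle c u v) c (‖u + v‖ / √2) (‖u - v‖ / √2) := by
  have hadd : u + v ≠ 0 := by
    intro e
    have := LinearIndependent.pair_iff.1 h 1 1 (by simpa using e)
    simp at this
  have hsub : u - v ≠ 0 := by
    intro e
    have := LinearIndependent.pair_iff.1 h 1 (-1) (by simpa [sub_eq_add_neg] using e)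
    simp at this
  have hm : 0 < ‖u + v‖ := norm_pos_iff.2 hadd
  have hn : 0 < ‖u - v‖ := norm_pos_iff.2 hsub
  have hm2 : ‖u + v‖ ^ 2 = 2 * (‖v‖ ^ 2 + inner ℝ u v) := by
    rw [norm_add_sq_real, huv]; ring
  have hn2 : ‖u - v‖ ^ 2 = 2 * (‖v‖ ^ 2 - inner ℝ u v) := by
    rw [norm_sub_sq_real, huv]; ring
  have horth : inner ℝ (u + v) (u - v) = 0 := by
    rw [inner_add_left, inner_sub_right, inner_sub_right, real_inner_self_eq_norm_sq,
      real_inner_self_eq_norm_sq, huv, real_inner_comm u v]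
    ring
  have hon : Orthonormal ℝ ![‖u + v‖⁻¹ • (u + v), ‖u - v‖⁻¹ • (u - v)] := by
    have h01 : inner ℝ (‖u + v‖⁻¹ • (u + v)) (‖u - v‖⁻¹ • (u - v)) = 0 := by
      rw [inner_smul_left, inner_smul_right, horth]; simp
    refine ⟨fun i => ?_, fun i j hij => ?_⟩
    · fin_cases i
      · exact norm_smul_inv_norm (𝕜 := ℝ) hadd
      · exact norm_smul_inv_norm (𝕜 := ℝ) hsub
    · fin_cases i <;> fin_cases j
      · exact absurd rfl hij
      · exact h01
      · exact (real_inner_comm _ _).trans h01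
      · exact absurd rfl hij
  let f : OrthonormalBasis (Fin 2) ℝ Plane := OrthonormalBasis.mk hon (by
    rw [hon.linearIndependent.span_eq_top_of_card_eq_finrank (by simp)])
  have hf0 : f 0 = ‖u + v‖⁻¹ • (u + v) := by simp [f]
  have hf1 : f 1 = ‖u - v‖⁻¹ • (u - v) := by simp [f]
  refine ⟨by positivity, ?_, f, ?_⟩
  · gcongr
    apply le_of_sq_le_sq _ hm.le
    rw [hm2, hn2]; linarith
  · ext P
    obtain ⟨x, y, hxy⟩ := pair_coords h (P - c)
    have hP : P = c + (x • u + y • v) := by rw [← hxy]; abel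
    have e0 : inner ℝ (f 0) (P - c) = (x + y) * ‖u + v‖ / 2 := by
      rw [hxy, hf0, inner_smul_left]
      simp only [inner_add_left, inner_add_right, inner_smul_right, real_inner_self_eq_norm_sq,
        real_inner_comm u v, huv]
      simp
      field_simp
      rw [hm2]; ring
    have e1 : inner ℝ (f 1) (P - c) = (x - y) * ‖u - v‖ / 2 := by
      rw [hxy, hf1, inner_smul_left]
      simp only [inner_sub_left, inner_add_right, inner_smul_right, real_inner_self_eq_norm_sq,
        real_inner_comm u v, huv]
      simp
      field_simp
      rw [hn2]; ring
    rw [Set.mem_ofPred_eq, e0, e1]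
    conv_lhs => rw [hP, add_mem_obliqueCircle_iff h]
    have h2 : (√2 : ℝ) ^ 2 = 2 := Real.sq_sqrt (by norm_num)
    apply Eq.congr_left
    rw [div_pow, div_pow, div_pow, div_pow, h2]
    field_simp
    ring

theorem isEllipse_obliqueCircle {c u v : Plane} (h : LinearIndependent ℝ ![u, v])
    (huv : ‖u‖ = ‖v‖) : ∃ a b, IsEllipseWith (obliqueCircle c u v) c a b := by
  rcases le_total 0 (inner ℝ u v : ℝ) with h0 | h0
  · exact ⟨_, _, isEllipseWith_obliqueCircle_of_inner_nonneg h huv h0⟩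
  · rw [← obliqueCircle_neg_right]
    refine ⟨_, _, isEllipseWith_obliqueCircle_of_inner_nonneg ?_ (by simpa using huv) ?_⟩
    · rw [LinearIndependent.pair_iff] at h ⊢
      intro s t e
      have := h s (-t) (by simpa using e)
      exact ⟨this.1, neg_eq_zero.1 this.2⟩
    · rw [inner_neg_right]; linarith

/-- The center of an ellipse is determined by its set of points: two centers of symmetry would yield a
translation preserving the bounded curve. -/
theorem HasCenter.eq_of_obliqueCircle {c c' u v : Plane} (h : LinearIndependent ℝ ![u, v])
    (hc : HasCenter (obliqueCircle c u v) c') : c' = c := by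
  obtain ⟨a, b, -, -, f, hE⟩ := hc
  have hsymm : ∀ P ∈ obliqueCircle c u v, (2 : ℝ) • c' - P ∈ obliqueCircle c u v := by
    intro P hP
    rw [hE] at hP ⊢
    rw [Set.mem_ofPred_eq] at hP ⊢
    have : (2 : ℝ) • c' - P - c' = -(P - c') := by module
    rw [this, inner_neg_right, inner_neg_right, neg_sq, neg_sq, hP]
  obtain ⟨x, y, hxy⟩ := pair_coords h (c' - c)
  have hc' : c' = c + (x • u + y • v) := by rw [← hxy]; abel
  -- translating by twice the difference of the two centers preserves the curve
  have key : ∀ α β : ℝ, α ^ 2 + β ^ 2 = 1 → (2 * x - α) ^ 2 + (2 * y - β) ^ 2 = 1 := by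
    intro α β e
    have := hsymm _ ((add_mem_obliqueCircle_iff (c := c) h).2 e)
    rw [← add_mem_obliqueCircle_iff (c := c) h]
    convert this using 1
    rw [hc']; module
  have h1 := key 1 0 (by norm_num)
  have h2 := key (-1) 0 (by norm_num)
  have hx : x = 0 := by nlinarith
  have hy : y = 0 := by
    rw [hx] at h1; nlinarith
  rw [hc', hx, hy]; simp

/-! ### Segments and parallel lines -/

theorem diam_segment_eq_dist (P Q : Plane) : Metric.diam (segment ℝ P Q) = dist P Q := by
  rw [← convexHull_pair, convexHull_diam, Metric.diam_pair]

theorem affineSpan_segment_eq_line (P Q : Plane) : affineSpan ℝ (segment ℝ P Q) = line[ℝ, P, Q] := by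
  rw [← convexHull_pair, affineSpan_convexHull]

theorem line_parallel_iff {X Y Z W : Plane} (hXY : X ≠ Y) :
    line[ℝ, X, Y] ∥ line[ℝ, Z, W] ↔ ∃ r : ℝ, Y - X = r • (W - Z) := by
  rw [AffineSubspace.affineSpan_pair_parallel_iff_vectorSpan_eq,
    Set.pair_comm X, Set.pair_comm Z, vectorSpan_pair, vectorSpan_pair]
  simp only [vsub_eq_sub]
  constructor
  · intro e
    have : Y - X ∈ Submodule.span ℝ {W - Z} := e ▸ Submodule.mem_span_singleton_self _
    obtain ⟨r, hr⟩ := Submodule.mem_span_singleton.1 this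
    exact ⟨r, hr.symm⟩
  · rintro ⟨r, hr⟩
    have hr0 : r ≠ 0 := by
      rintro rfl
      rw [zero_smul, sub_eq_zero] at hr
      exact hXY hr.symm
    rw [hr]
    exact Submodule.span_singleton_smul_eq (IsUnit.mk0 r hr0) _

/-! ### Ellipses inscribed in a kite -/

/-- The ellipses inscribed in the kite with vertices `(±1, 0)`, `(0, p)`, `(0, -q)` have equations
`x ^ 2 / t + (y - k) ^ 2 / g = 1` with `0 < t < 1`; this is `g` as a function of `t`. -/
noncomputable def kiteSemiaxisSq (p q t : ℝ) : ℝ := (1 - t) * ((p + q) ^ 2 - (p - q) ^ 2 * t) / 4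

/-- The ordinate `k` of the center `(0, k)` of the ellipse inscribed in the kite with vertices
`(±1, 0)`, `(0, p)`, `(0, -q)` whose squared semidiameter along the first axis is `t`. -/
noncomputable def kiteCenter (p q t : ℝ) : ℝ := (p - q) * (1 - t) / 2

/-- Tangency to a side, in oblique coordinates: the point of the side with parameter `s` lies on the
ellipse, and the direction of the side is conjugate there to the radius. -/
theorem isTangentToSide_coords_iff {E : Set Plane} {O u v X Y : Plane}
    {A B C c₁ c₂ x₁ y₁ x₂ y₂ : ℝ} (hA : 0 < A) (hD : 0 < A * C - B ^ 2)
    (hE : ∀ x y : ℝ, O + (x • u + y • v) ∈ E ↔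
        A * (x - c₁) ^ 2 + 2 * B * (x - c₁) * (y - c₂) + C * (y - c₂) ^ 2 = 1)
    (hXY : X ≠ Y) (hX : X = O + (x₁ • u + y₁ • v)) (hY : Y = O + (x₂ • u + y₂ • v)) :
    IsTangentToSide E X Y ↔ ∃ s ∈ Set.Icc (0 : ℝ) 1,
      (A * (x₂ - x₁) ^ 2 + 2 * B * (x₂ - x₁) * (y₂ - y₁) + C * (y₂ - y₁) ^ 2) * s +
        (A * (x₁ - c₁) * (x₂ - x₁) + B * ((x₁ - c₁) * (y₂ - y₁) + (y₁ - c₂) * (x₂ - x₁)) +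
          C * (y₁ - c₂) * (y₂ - y₁)) = 0 ∧
      A * (x₁ + s * (x₂ - x₁) - c₁) ^ 2 +
        2 * B * (x₁ + s * (x₂ - x₁) - c₁) * (y₁ + s * (y₂ - y₁) - c₂) +
        C * (y₁ + s * (y₂ - y₁) - c₂) ^ 2 = 1 := by
  have hk : 0 < A * (x₂ - x₁) ^ 2 + 2 * B * (x₂ - x₁) * (y₂ - y₁) + C * (y₂ - y₁) ^ 2 := by
    have h1 : A * (A * (x₂ - x₁) ^ 2 + 2 * B * (x₂ - x₁) * (y₂ - y₁) + C * (y₂ - y₁) ^ 2)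
      = (A * (x₂ - x₁) + B * (y₂ - y₁)) ^ 2 + (A * C - B ^ 2) * (y₂ - y₁) ^ 2 := by ring
    refine pos_of_mul_pos_right (h1 ▸ ?_) hA.le
    by_cases hy : y₂ - y₁ = 0
    · have hx : x₂ - x₁ ≠ 0 := by
        intro hx
        apply hXY
        rw [hX, hY, sub_eq_zero.1 hx, sub_eq_zero.1 hy]
      rw [hy]
      have : A * (x₂ - x₁) ≠ 0 := mul_ne_zero hA.ne' hx
      simp only [mul_zero, add_zero]
      positivity
    · positivity
  have hl : ∀ s : ℝ, AffineMap.lineMap X Y s =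
      O + ((x₁ + s * (x₂ - x₁)) • u + (y₁ + s * (y₂ - y₁)) • v) := by
    intro s
    rw [AffineMap.lineMap_apply_module', hX, hY]
    module
  rw [isTangentToSide_iff hXY hk (m := A * (x₁ - c₁) * (x₂ - x₁) +
    B * ((x₁ - c₁) * (y₂ - y₁) + (y₁ - c₂) * (x₂ - x₁)) + C * (y₁ - c₂) * (y₂ - y₁))
    (n := A * (x₁ - c₁) ^ 2 + 2 * B * (x₁ - c₁) * (y₁ - c₂) + C * (y₁ - c₂) ^ 2)]
  · refine exists_congr fun s => and_congr_right fun _ => and_congr_right fun _ => ?_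
    apply Eq.congr_left
    ring
  · intro s
    rw [hl, hE]
    apply Eq.congr_left
    ring

/-- The vanishing of the discriminant for a tangent side, rewritten with Lagrange's identity: the right-hand
side holds the cross product of the direction of the side with the radius to a vertex. -/
theorem discr_eq_of_isTangentToSide {E : Set Plane} {O u v X Y : Plane}
    {A B C c₁ c₂ x₁ y₁ x₂ y₂ : ℝ} (hA : 0 < A) (hD : 0 < A * C - B ^ 2)
    (hE : ∀ x y : ℝ, O + (x • u + y • v) ∈ E ↔
        A * (x - c₁) ^ 2 + 2 * B * (x - c₁) * (y - c₂) + C * (y - c₂) ^ 2 = 1)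
    (hXY : X ≠ Y) (hX : X = O + (x₁ • u + y₁ • v)) (hY : Y = O + (x₂ • u + y₂ • v))
    (h : IsTangentToSide E X Y) :
    A * (x₂ - x₁) ^ 2 + 2 * B * (x₂ - x₁) * (y₂ - y₁) + C * (y₂ - y₁) ^ 2 =
      (A * C - B ^ 2) * ((x₁ - c₁) * (y₂ - y₁) - (y₁ - c₂) * (x₂ - x₁)) ^ 2 := by
  obtain ⟨s, -, h1, h2⟩ := (isTangentToSide_coords_iff hA hD hE hXY hX hY).1 h
  obtain ⟨k, hk⟩ : ∃ k, k = A * (x₂ - x₁) ^ 2 + 2 * B * (x₂ - x₁) * (y₂ - y₁) +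
    C * (y₂ - y₁) ^ 2 := ⟨_, rfl⟩
  obtain ⟨m, hm⟩ : ∃ m, m = A * (x₁ - c₁) * (x₂ - x₁) +
    B * ((x₁ - c₁) * (y₂ - y₁) + (y₁ - c₂) * (x₂ - x₁)) + C * (y₁ - c₂) * (y₂ - y₁) := ⟨_, rfl⟩
  obtain ⟨n, hn⟩ : ∃ n, n = A * (x₁ - c₁) ^ 2 + 2 * B * (x₁ - c₁) * (y₁ - c₂) +
    C * (y₁ - c₂) ^ 2 := ⟨_, rfl⟩
  have h3 : k * s ^ 2 + 2 * m * s + n = 1 := by rw [← h2, hk, hm, hn]; ring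
  rw [← hk, ← hm] at h1
  have h4 : n * k - m ^ 2 =
      (A * C - B ^ 2) * ((x₁ - c₁) * (y₂ - y₁) - (y₁ - c₂) * (x₂ - x₁)) ^ 2 := by
    rw [hk, hm, hn]; ring
  rw [← h4, ← hk]
  linear_combination (-k) * h3 + (k * s + m) * h1

/-- In the oblique frame `(O; u, v)` the points `A i` are the vertices `(-1, 0)`, `(0, p)`, `(1, 0)`,
`(0, -q)` of a kite. All coordinates are written out so that the four vertices are
treated uniformly. -/
structure IsKite (A : Fin 4 → Plane) (O u v : Plane) (p q : ℝ) : Prop where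
  li : LinearIndependent ℝ ![u, v]
  p_pos : 0 < p
  q_pos : 0 < q
  vertex_zero : A 0 = O + ((-1 : ℝ) • u + (0 : ℝ) • v)
  vertex_one : A 1 = O + ((0 : ℝ) • u + p • v)
  vertex_two : A 2 = O + ((1 : ℝ) • u + (0 : ℝ) • v)
  vertex_three : A 3 = O + ((0 : ℝ) • u + (-q) • v)

variable {A : Fin 4 → Plane} {O u v : Plane} {p q : ℝ}

theorem coords_ne (h : LinearIndependent ℝ ![u, v]) {x y x' y' : ℝ} (hx : x ≠ x') :
    O + (x • u + y • v) ≠ O + (x' • u + y' • v) := fun e =>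
  hx (pair_coords_inj h (add_left_cancel e)).1

theorem IsKite.coord_le_one (hK : IsKite A O u v p q) {x y : ℝ}
    (h : O + (x • u + y • v) ∈ convexHull ℝ (Set.range A)) : x ≤ 1 := by
  have hsub : convexHull ℝ (Set.range A) ⊆ {P | ∃ x y : ℝ, x ≤ 1 ∧ P = O + (x • u + y • v)} := by
    apply convexHull_min
    · rintro _ ⟨i, rfl⟩
      fin_cases i
      · exact ⟨_, _, by norm_num, hK.vertex_zero⟩
      · exact ⟨_, _, by norm_num, hK.vertex_one⟩
      · exact ⟨_, _, by norm_num, hK.vertex_two⟩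
      · exact ⟨_, _, by norm_num, hK.vertex_three⟩
    · rintro _ ⟨x, y, hx, rfl⟩ _ ⟨x', y', hx', rfl⟩ a b ha hb hab
      refine ⟨a * x + b * x', a * y + b * y', by nlinarith, ?_⟩
      have : O = (a + b) • O := by rw [hab, one_smul]
      conv_rhs => rw [this]
      module
  obtain ⟨x', y', hx, e⟩ := hsub h
  rw [(pair_coords_inj hK.li (add_left_cancel e)).1]
  exact hx

theorem IsKite.mem_convexHull (hK : IsKite A O u v p q) {x y : ℝ}
    (h1 : p * x + y ≤ p) (h2 : -(p * x) + y ≤ p) (h3 : q * x - y ≤ q) (h4 : -(q * x) - y ≤ q) :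
    O + (x • u + y • v) ∈ convexHull ℝ (Set.range A) := by
  have hp := hK.p_pos
  have hq := hK.q_pos
  have hmem : ∀ i, A i ∈ convexHull ℝ (Set.range A) := fun i =>
    subset_convexHull ℝ _ (Set.mem_range_self i)
  have key : ∀ w : Fin 4 → ℝ, (∀ i, 0 ≤ w i) → w 0 + w 1 + w 2 + w 3 = 1 →
      w 0 • A 0 + w 1 • A 1 + w 2 • A 2 + w 3 • A 3 ∈ convexHull ℝ (Set.range A) := by
    intro w hw hs
    rw [← Fin.sum_univ_four (fun i => w i • A i)]
    exact (convex_convexHull ℝ _).sum_mem (fun i _ => hw i)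
      (by rw [Fin.sum_univ_four, hs]) (fun i _ => hmem i)
  rcases le_total 0 y with hy | hy
  · have hw : ∀ i, 0 ≤ ![(1 - y / p - x) / 2, y / p, (1 - y / p + x) / 2, 0] i := by
      have e1 : 0 ≤ (1 - y / p - x) / 2 := by
        rw [show (1 - y / p - x) / 2 = (p - (p * x + y)) / (2 * p) by field_simp; ring]
        have := sub_nonneg.2 h1
        positivity
      have e2 : 0 ≤ (1 - y / p + x) / 2 := by
        rw [show (1 - y / p + x) / 2 = (p - (-(p * x) + y)) / (2 * p) by field_simp; ring]
        have := sub_nonneg.2 h2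
        positivity
      have e3 : 0 ≤ y / p := by positivity
      intro i; fin_cases i
      exacts [e1, e3, e2, le_rfl]
    convert key _ hw (by simp; ring) using 1
    simp only [Matrix.cons_val]
    rw [hK.vertex_zero, hK.vertex_one, hK.vertex_two, hK.vertex_three]
    match_scalars <;> field_simp <;> ring
  · have hw : ∀ i, 0 ≤ ![(1 + y / q - x) / 2, 0, (1 + y / q + x) / 2, -y / q] i := by
      have e1 : 0 ≤ (1 + y / q - x) / 2 := by
        rw [show (1 + y / q - x) / 2 = (q - (q * x - y)) / (2 * q) by field_simp; ring]
        have := sub_nonneg.2 h3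
        positivity
      have e2 : 0 ≤ (1 + y / q + x) / 2 := by
        rw [show (1 + y / q + x) / 2 = (q - (-(q * x) - y)) / (2 * q) by field_simp; ring]
        have := sub_nonneg.2 h4
        positivity
      have e3 : 0 ≤ -y / q := by
        have := neg_nonneg.2 hy
        positivity
      intro i; fin_cases i
      exacts [e1, le_rfl, e2, e3]
    convert key _ hw (by simp; ring) using 1
    simp only [Matrix.cons_val]
    rw [hK.vertex_zero, hK.vertex_one, hK.vertex_two, hK.vertex_three]
    match_scalars <;> field_simp <;> ring

theorem kiteSemiaxisSq_pos (hp : 0 < p) (hq : 0 < q) {t : ℝ} (ht : t ∈ Set.Ioo (0 : ℝ) 1) :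
    0 < kiteSemiaxisSq p q t := by
  obtain ⟨h0, h1⟩ := ht
  have : 0 < (p + q) ^ 2 - (p - q) ^ 2 * t := by
    nlinarith [mul_pos hp hq, sq_nonneg (p - q)]
  have := sub_pos.2 h1
  unfold kiteSemiaxisSq
  positivity

/-- Every ellipse inscribed in a kite belongs to the one-parameter family, whichever presentation by
center and semi-axes is chosen; the semi-axes are recovered through their symmetric functions. The
tangency conditions on opposite sides of the first diagonal force the mixed coefficient and the
abscissa of the center to vanish. -/
theorem IsKite.of_isInscribed (hK : IsKite A O u v p q) {E : Set Plane} (hE : IsInscribed E A)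
    {c : Plane} {a b : ℝ} (hab : IsEllipseWith E c a b) :
    ∃ t ∈ Set.Ioo (0 : ℝ) 1,
      (∀ x y : ℝ, O + (x • u + y • v) ∈ E ↔
        x ^ 2 / t + (y - kiteCenter p q t) ^ 2 / kiteSemiaxisSq p q t = 1) ∧
      a ^ 2 * b ^ 2 =
        t * kiteSemiaxisSq p q t * (‖u‖ ^ 2 * ‖v‖ ^ 2 - inner ℝ u v ^ 2) ∧
      a ^ 2 + b ^ 2 = t * ‖u‖ ^ 2 + kiteSemiaxisSq p q t * ‖v‖ ^ 2 := by
  obtain ⟨c₁, c₂, hc⟩ := pair_coords hK.li (c - O)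
  have hc' : c = O + (c₁ • u + c₂ • v) := by rw [← hc]; abel
  obtain ⟨α, β, γ, hα, hγ, hD, hmem, hdet, htr⟩ := hab.exists_quadratic hK.li hc'
  have hp := hK.p_pos
  have hq := hK.q_pos
  have hG := gram_pos hK.li
  have n01 : A 0 ≠ A 1 := by rw [hK.vertex_zero, hK.vertex_one]; exact coords_ne hK.li (by norm_num)
  have n12 : A 1 ≠ A 2 := by rw [hK.vertex_one, hK.vertex_two]; exact coords_ne hK.li (by norm_num)
  have n23 : A 2 ≠ A 3 := by rw [hK.vertex_two, hK.vertex_three]; exact coords_ne hK.li (by norm_num)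
  have n30 : A 3 ≠ A 0 := by rw [hK.vertex_three, hK.vertex_zero]; exact coords_ne hK.li (by norm_num)
  have t0 := discr_eq_of_isTangentToSide hα hD hmem n01 hK.vertex_zero hK.vertex_one (hE.2.2 0)
  have t1 := discr_eq_of_isTangentToSide hα hD hmem n12 hK.vertex_one hK.vertex_two (hE.2.2 1)
  have t2 := discr_eq_of_isTangentToSide hα hD hmem n23 hK.vertex_two hK.vertex_three (hE.2.2 2)
  have t3 := discr_eq_of_isTangentToSide hα hD hmem n30 hK.vertex_three hK.vertex_zero (hE.2.2 3)
  have e1 : β = (α * γ - β ^ 2) * c₁ * (p - c₂) := by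
    apply mul_left_cancel₀ hp.ne'
    linear_combination (t0 - t1) / 4
  have e2 : β = -((α * γ - β ^ 2) * c₁ * (q + c₂)) := by
    apply mul_left_cancel₀ hq.ne'
    linear_combination (t2 - t3) / 4
  -- the two expressions for `β` differ by a nonzero multiple of `c₁`
  have hc1 : c₁ = 0 := by
    have : (α * γ - β ^ 2) * (p + q) * c₁ = 0 := by linear_combination e2 - e1
    have hne : (α * γ - β ^ 2) * (p + q) ≠ 0 := by positivity
    exact (mul_eq_zero.1 this).resolve_left hne
  have hβ : β = 0 := by rw [e1, hc1]; ring
  subst hc1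
  subst hβ
  have hs1 : α + γ * p ^ 2 = α * γ * (p - c₂) ^ 2 := by linear_combination t0
  have hs2 : α + γ * q ^ 2 = α * γ * (q + c₂) ^ 2 := by linear_combination t2
  -- tangency to the side lines does not exclude `1 / α > 1`; containment in the kite does
  have hα1 : 1 ≤ α := by
    have : O + ((1 / √α) • u + c₂ • v) ∈ E := by
      rw [hmem]
      simp [Real.sq_sqrt hα.le, hα.ne']
    have := hK.coord_le_one (hE.2.1 this)
    rw [div_le_one (by positivity)] at this
    simpa using this
  have hc2 : c₂ = kiteCenter p q (1 / α) := by
    unfold kiteCenter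
    have h1 : (p + q) * (α * (p - q - 2 * c₂)) = (p + q) * (p - q) := by
      apply mul_left_cancel₀ hγ.ne'
      linear_combination hs2 - hs1
    have h2 := mul_left_cancel₀ (by positivity : p + q ≠ 0) h1
    field_simp
    linear_combination -h2
  have hg : 1 / γ = kiteSemiaxisSq p q (1 / α) := by
    have : 1 / γ = (p - c₂) ^ 2 - p ^ 2 * (1 / α) := by
      field_simp
      linear_combination hs1
    rw [this, hc2, kiteCenter, kiteSemiaxisSq]
    field_simp
    ring
  have hαne : α ≠ 1 := by
    rintro rfl
    have : 1 / γ = 0 := by rw [hg]; simp [kiteSemiaxisSq]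
    have : 0 < 1 / γ := by positivity
    linarith
  refine ⟨1 / α, ⟨by positivity, ?_⟩, fun x y => ?_, ?_, ?_⟩
  · rw [div_lt_one hα]; exact lt_of_le_of_ne hα1 (Ne.symm hαne)
  · rw [hmem, ← hc2, ← hg]
    apply Eq.congr_left
    field_simp
    ring
  · rw [← hg, ← hdet]; field_simp; ring
  · rw [← hg]
    apply mul_right_cancel₀ hG.ne'
    rw [htr, ← hdet]
    field_simp
    ring

/-- Every member of the one-parameter family that is known to be an ellipse is inscribed in the
kite. -/
theorem IsKite.isInscribed (hK : IsKite A O u v p q) {E : Set Plane} {t : ℝ}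
    (ht : t ∈ Set.Ioo (0 : ℝ) 1) (hell : IsEllipse E)
    (hE : ∀ x y : ℝ, O + (x • u + y • v) ∈ E ↔
        x ^ 2 / t + (y - kiteCenter p q t) ^ 2 / kiteSemiaxisSq p q t = 1) :
    IsInscribed E A := by
  have hp := hK.p_pos
  have hq := hK.q_pos
  have hg := kiteSemiaxisSq_pos hp hq ht
  obtain ⟨ht0, ht1⟩ := ht
  obtain ⟨g, hgd⟩ : ∃ g, g = kiteSemiaxisSq p q t := ⟨_, rfl⟩
  obtain ⟨k, hkd⟩ : ∃ k, k = kiteCenter p q t := ⟨_, rfl⟩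
  rw [← hgd] at hE hg
  rw [← hkd] at hE
  have hs1 : g + p ^ 2 * t = (p - k) ^ 2 := by
    rw [hgd, hkd, kiteSemiaxisSq, kiteCenter]; ring
  have hs2 : g + q ^ 2 * t = (q + k) ^ 2 := by
    rw [hgd, hkd, kiteSemiaxisSq, kiteCenter]; ring
  have hpk : p * t ≤ p - k := by rw [hkd, kiteCenter]; nlinarith
  have hqk : q * t ≤ q + k := by rw [hkd, kiteCenter]; nlinarith
  have hpk0 : 0 < p - k := lt_of_lt_of_le (by positivity) hpk
  have hqk0 : 0 < q + k := lt_of_lt_of_le (by positivity) hqk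
  have hE' : ∀ x y : ℝ, O + (x • u + y • v) ∈ E ↔
      1 / t * (x - 0) ^ 2 + 2 * 0 * (x - 0) * (y - k) + 1 / g * (y - k) ^ 2 = 1 := by
    intro x y
    rw [hE]
    apply Eq.congr_left
    ring
  have hA : 0 < 1 / t := by positivity
  have hD : 0 < 1 / t * (1 / g) - 0 ^ 2 := by
    have : 0 < 1 / t * (1 / g) := by positivity
    linarith
  refine ⟨hell, ?_, ?_⟩
  · intro P hP
    obtain ⟨x, y, hxy⟩ := pair_coords hK.li (P - O)
    have hP' : P = O + (x • u + y • v) := by rw [← hxy]; abel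
    rw [hP'] at hP ⊢
    rw [hE] at hP
    have hxyE : g * x ^ 2 + t * (y - k) ^ 2 = g * t := by
      field_simp at hP; linear_combination hP
    -- Cauchy–Schwarz for the quadratic form of the ellipse
    have cs : ∀ r : ℝ, (r * x + (y - k)) ^ 2 ≤ g + r ^ 2 * t := by
      intro r
      have h1 : g * t * (g + r ^ 2 * t - (r * x + (y - k)) ^ 2) =
          (g * x - r * t * (y - k)) ^ 2 := by
        linear_combination (-(g + r ^ 2 * t)) * hxyE
      have h2 := nonneg_of_mul_nonneg_right (h1 ▸ sq_nonneg _) (mul_pos hg ht0)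
      linarith
    have b1 := abs_le_of_sq_le_sq (hs1 ▸ cs p) hpk0.le
    have c2 := cs (-p)
    have c4 := cs (-q)
    rw [neg_sq, hs1] at c2
    rw [neg_sq, hs2] at c4
    have b2 := abs_le_of_sq_le_sq c2 hpk0.le
    have b3 := abs_le_of_sq_le_sq (hs2 ▸ cs q) hqk0.le
    have b4 := abs_le_of_sq_le_sq c4 hqk0.le
    rw [abs_le] at b1 b2 b3 b4
    exact hK.mem_convexHull (by linarith) (by linarith) (by linarith) (by linarith)
  · have n01 : A 0 ≠ A 1 := by rw [hK.vertex_zero, hK.vertex_one]; exact coords_ne hK.li (by norm_num)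
    have n12 : A 1 ≠ A 2 := by rw [hK.vertex_one, hK.vertex_two]; exact coords_ne hK.li (by norm_num)
    have n23 : A 2 ≠ A 3 := by rw [hK.vertex_two, hK.vertex_three]; exact coords_ne hK.li (by norm_num)
    have n30 : A 3 ≠ A 0 := by rw [hK.vertex_three, hK.vertex_zero]; exact coords_ne hK.li (by norm_num)
    have hr1 : p * t / (p - k) ∈ Set.Icc (0 : ℝ) 1 :=
      ⟨by positivity, by rw [div_le_one hpk0]; exact hpk⟩
    have hr2 : q * t / (q + k) ∈ Set.Icc (0 : ℝ) 1 :=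
      ⟨by positivity, by rw [div_le_one hqk0]; exact hqk⟩
    have hgp : g = (p - k) ^ 2 - p ^ 2 * t := by linear_combination hs1
    have hgq : g = (q + k) ^ 2 - q ^ 2 * t := by linear_combination hs2
    intro i
    fin_cases i
    · refine (isTangentToSide_coords_iff hA hD hE' n01 hK.vertex_zero hK.vertex_one).2
        ⟨1 - p * t / (p - k), ⟨by linarith [hr1.2], by linarith [hr1.1]⟩, ?_, ?_⟩ <;>
      · field_simp
        rw [hgp]
        ring
    · refine (isTangentToSide_coords_iff hA hD hE' n12 hK.vertex_one hK.vertex_two).2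
        ⟨p * t / (p - k), hr1, ?_, ?_⟩ <;>
      · field_simp
        rw [hgp]
        ring
    · refine (isTangentToSide_coords_iff hA hD hE' n23 hK.vertex_two hK.vertex_three).2
        ⟨1 - q * t / (q + k), ⟨by linarith [hr2.2], by linarith [hr2.1]⟩, ?_, ?_⟩ <;>
      · field_simp
        rw [hgq]
        ring
    · refine (isTangentToSide_coords_iff hA hD hE' n30 hK.vertex_three hK.vertex_zero).2
        ⟨q * t / (q + k), hr2, ?_, ?_⟩ <;>
      · field_simp
        rw [hgq]
        ring

/-! ### The inscribed ellipse of minimal eccentricity -/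

theorem linearIndependent_smul_pair {u v : Plane} (h : LinearIndependent ℝ ![u, v]) {r s : ℝ}
    (hr : r ≠ 0) (hs : s ≠ 0) : LinearIndependent ℝ ![r • u, s • v] := by
  rw [LinearIndependent.pair_iff] at h ⊢
  intro x y e
  rw [smul_smul, smul_smul] at e
  have := h _ _ e
  simpa [hr, hs] using this

theorem linearIndependent_pair_swap {u v : Plane} (h : LinearIndependent ℝ ![u, v]) :
    LinearIndependent ℝ ![v, u] := by
  rw [LinearIndependent.pair_iff] at h ⊢
  intro x y e
  exact (h y x (by rw [← e, add_comm])).symm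

/-- Comparing eccentricities amounts to comparing `(a ^ 2 + b ^ 2) ^ 2 / (a ^ 2 * b ^ 2)`, since
`(1 + x) ^ 2 / x` is strictly decreasing for `x = b ^ 2 / a ^ 2` in `(0, 1]`. -/
theorem sqrt_one_sub_le_sqrt_one_sub_iff {a b a' b' : ℝ} (hb : 0 < b) (hba : b ≤ a) (hb' : 0 < b')
    (hba' : b' ≤ a') :
    √(1 - b ^ 2 / a ^ 2) ≤ √(1 - b' ^ 2 / a' ^ 2) ↔
      (a ^ 2 + b ^ 2) ^ 2 * (a' ^ 2 * b' ^ 2) ≤ (a' ^ 2 + b' ^ 2) ^ 2 * (a ^ 2 * b ^ 2) := by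
  have ha : 0 < a := hb.trans_le hba
  have ha' : 0 < a' := hb'.trans_le hba'
  have h1 : b ^ 2 / a ^ 2 ≤ 1 := by rw [div_le_one (by positivity)]; gcongr
  have h1' : b' ^ 2 / a' ^ 2 ≤ 1 := by rw [div_le_one (by positivity)]; gcongr
  rw [Real.sqrt_le_sqrt_iff (by linarith), sub_le_sub_iff_left]
  set x := b ^ 2 / a ^ 2 with hx
  set y := b' ^ 2 / a' ^ 2 with hy
  have hx0 : 0 < x := by positivity
  have hy0 : 0 < y := by positivity
  have e : (a' ^ 2 + b' ^ 2) ^ 2 * (a ^ 2 * b ^ 2) - (a ^ 2 + b ^ 2) ^ 2 * (a' ^ 2 * b' ^ 2) =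
      a ^ 4 * a' ^ 4 * ((x - y) * (1 - x * y)) := by
    rw [hx, hy]; field_simp; ring
  rw [← sub_nonneg (b := (a ^ 2 + b ^ 2) ^ 2 * (a' ^ 2 * b' ^ 2)), e]
  constructor
  · intro h
    have : x * y ≤ 1 := mul_le_one₀ h1 hy0.le h1'
    have := sub_nonneg.2 this
    have := sub_nonneg.2 h
    positivity
  · intro h
    by_contra! hlt
    have hx1 : x < 1 := hlt.trans_le h1'
    have hxy : x * y < 1 := by nlinarith
    have : (x - y) * (1 - x * y) < 0 := mul_neg_of_neg_of_pos (by linarith) (by linarith)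
    have : a ^ 4 * a' ^ 4 * ((x - y) * (1 - x * y)) < 0 :=
      mul_neg_of_pos_of_neg (by positivity) this
    linarith

theorem kiteSemiaxisSq_strictAnti {p q : ℝ} (hp : 0 < p) (hq : 0 < q) {t t' : ℝ}
    (h : t < t') (h1 : t' < 1) : kiteSemiaxisSq p q t' < kiteSemiaxisSq p q t := by
  have h2 : 0 < (p + q) ^ 2 - (p - q) ^ 2 * t' := by
    nlinarith [mul_pos hp hq, sq_nonneg (p - q)]
  have h3 : (p - q) ^ 2 * t ≤ (p - q) ^ 2 * t' := by gcongr
  have : (1 - t') * ((p + q) ^ 2 - (p - q) ^ 2 * t') < (1 - t) * ((p + q) ^ 2 - (p - q) ^ 2 * t) :=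
    mul_lt_mul_of_pos_of_nonneg' (by linarith) (by linarith) h2 (by linarith)
  unfold kiteSemiaxisSq
  linarith

/-- Some member of the family has semidiameters of equal length along the two diagonals; here `K` and
`L` stand for the squared lengths of the frame vectors. -/
theorem exists_mul_eq_kiteSemiaxisSq_mul {p q : ℝ} (hp : 0 < p) (hq : 0 < q) {K L : ℝ}
    (hK : 0 < K) (hL : 0 < L) : ∃ t ∈ Set.Ioo (0 : ℝ) 1, t * K = kiteSemiaxisSq p q t * L := by
  have hc : ContinuousOn (fun t : ℝ => t * K - kiteSemiaxisSq p q t * L) (Set.Icc 0 1) := by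
    unfold kiteSemiaxisSq; fun_prop
  have := intermediate_value_Ioo zero_le_one hc
  obtain ⟨t, ht, e⟩ := this (show (0 : ℝ) ∈ _ by
    constructor
    · simp only [kiteSemiaxisSq]
      have : 0 < (p + q) ^ 2 * L := by positivity
      linarith
    · simpa [kiteSemiaxisSq] using hK)
  exact ⟨t, ht, sub_eq_zero.1 e⟩

theorem eq_of_mul_eq_kiteSemiaxisSq_mul {p q : ℝ} (hp : 0 < p) (hq : 0 < q) {K L t t' : ℝ}
    (hK : 0 < K) (hL : 0 < L) (ht : t ∈ Set.Ioo (0 : ℝ) 1) (ht' : t' ∈ Set.Ioo (0 : ℝ) 1)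
    (h : t * K = kiteSemiaxisSq p q t * L) (h' : t' * K = kiteSemiaxisSq p q t' * L) :
    t = t' := by
  rcases lt_trichotomy t t' with hlt | heq | hlt
  · have h1 := mul_lt_mul_of_pos_right hlt hK
    have h2 := mul_lt_mul_of_pos_right (kiteSemiaxisSq_strictAnti hp hq hlt ht'.2) hL
    linarith
  · exact heq
  · have h1 := mul_lt_mul_of_pos_right hlt hK
    have h2 := mul_lt_mul_of_pos_right (kiteSemiaxisSq_strictAnti hp hq hlt ht.2) hL
    linarith

/-- The inscribed ellipse of minimal eccentricity exists, is unique, and is the member of the family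
whose semidiameters `r • u` and `s • v` along the diagonals have the same length. -/
theorem IsKite.exists_minimal (hK : IsKite A O u v p q) :
    ∃ (c : Plane) (r s : ℝ), 0 < r ∧ 0 < s ∧ ‖r • u‖ = ‖s • v‖ ∧
      IsMinimalEccentricityInscribed (obliqueCircle c (r • u) (s • v)) A ∧
      ∀ E, IsMinimalEccentricityInscribed E A → E = obliqueCircle c (r • u) (s • v) := by
  have hp := hK.p_pos
  have hq := hK.q_pos
  have hu : 0 < ‖u‖ ^ 2 := by
    have : u ≠ 0 := hK.li.ne_zero 0
    positivity
  have hv : 0 < ‖v‖ ^ 2 := by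
    have : v ≠ 0 := hK.li.ne_zero 1
    positivity
  have hG := gram_pos hK.li
  obtain ⟨t, ht, hbal⟩ := exists_mul_eq_kiteSemiaxisSq_mul hp hq hu hv
  have hg := kiteSemiaxisSq_pos hp hq ht
  have hr : 0 < √t := Real.sqrt_pos.2 ht.1
  have hs : 0 < √(kiteSemiaxisSq p q t) := Real.sqrt_pos.2 hg
  have hr2 : √t ^ 2 = t := Real.sq_sqrt ht.1.le
  have hs2 : √(kiteSemiaxisSq p q t) ^ 2 = kiteSemiaxisSq p q t := Real.sq_sqrt hg.le
  have hnorm : ‖√t • u‖ = ‖√(kiteSemiaxisSq p q t) • v‖ := by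
    rw [← sq_eq_sq₀ (norm_nonneg _) (norm_nonneg _), norm_smul, norm_smul, mul_pow, mul_pow,
      Real.norm_eq_abs, Real.norm_eq_abs, sq_abs, sq_abs, hr2, hs2, hbal]
  have hli := linearIndependent_smul_pair hK.li hr.ne' hs.ne'
  set E₀ := obliqueCircle (O + kiteCenter p q t • v) (√t • u) (√(kiteSemiaxisSq p q t) • v) with hE₀
  have hmem : ∀ x y : ℝ, O + (x • u + y • v) ∈ E₀ ↔
        x ^ 2 / t + (y - kiteCenter p q t) ^ 2 / kiteSemiaxisSq p q t = 1 := by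
    intro x y
    have e : O + (x • u + y • v) = (O + kiteCenter p q t • v) + ((x / √t) • (√t • u) +
        ((y - kiteCenter p q t) / √(kiteSemiaxisSq p q t)) • (√(kiteSemiaxisSq p q t) • v)) := by
      rw [smul_smul, smul_smul, div_mul_cancel₀ _ hr.ne', div_mul_cancel₀ _ hs.ne']
      module
    rw [e, hE₀, add_mem_obliqueCircle_iff hli, div_pow, div_pow, hr2, hs2]
  have hins : IsInscribed E₀ A := by
    obtain ⟨a, b, hab⟩ := isEllipse_obliqueCircle (c := O + kiteCenter p q t • v) hli hnorm
    exact hK.isInscribed ht ⟨_, a, b, hab⟩ hmem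
  have ext_of : ∀ {E : Set Plane}, (∀ x y : ℝ, O + (x • u + y • v) ∈ E ↔
      x ^ 2 / t + (y - kiteCenter p q t) ^ 2 / kiteSemiaxisSq p q t = 1) → E = E₀ := by
    intro E h
    ext P
    obtain ⟨x, y, hxy⟩ := pair_coords hK.li (P - O)
    have hP : P = O + (x • u + y • v) := by rw [← hxy]; abel
    rw [hP, h, hmem]
  -- the parameter is determined by the curve: its points have extreme `u`-coordinate `√t`
  have param : ∀ {c : Plane} {a b : ℝ}, IsEllipseWith E₀ c a b →
      a ^ 2 * b ^ 2 =
        t * kiteSemiaxisSq p q t * (‖u‖ ^ 2 * ‖v‖ ^ 2 - inner ℝ u v ^ 2) ∧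
      a ^ 2 + b ^ 2 = t * ‖u‖ ^ 2 + kiteSemiaxisSq p q t * ‖v‖ ^ 2 := by
    intro c a b hab
    obtain ⟨t', ht', h1, h2, h3⟩ := hK.of_isInscribed hins hab
    have hg' := kiteSemiaxisSq_pos hp hq ht'
    have e1 := (h1 (√t) (kiteCenter p q t)).1 ((hmem _ _).2 (by
      rw [hr2, sub_self, div_self ht.1.ne']; simp))
    have e2 := (hmem (√t') (kiteCenter p q t')).1 ((h1 _ _).2 (by
      rw [Real.sq_sqrt ht'.1.le, sub_self, div_self ht'.1.ne']; simp))
    rw [hr2] at e1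
    rw [Real.sq_sqrt ht'.1.le] at e2
    have i1 : t / t' ≤ 1 := by
      have : 0 ≤ (kiteCenter p q t - kiteCenter p q t') ^ 2 / kiteSemiaxisSq p q t' := by positivity
      linarith
    have i2 : t' / t ≤ 1 := by
      have : 0 ≤ (kiteCenter p q t' - kiteCenter p q t) ^ 2 / kiteSemiaxisSq p q t := by positivity
      linarith
    rw [div_le_one ht'.1] at i1
    rw [div_le_one ht.1] at i2
    obtain rfl := le_antisymm i1 i2
    exact ⟨h2, h3⟩
  refine ⟨O + kiteCenter p q t • v, √t, √(kiteSemiaxisSq p q t), hr, hs, hnorm, ⟨hins, ?_⟩, ?_⟩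
  · rintro E' hE' e e' ⟨c, a, b, hab, rfl⟩ ⟨c', a', b', hab', rfl⟩
    obtain ⟨h2, h3⟩ := param hab
    obtain ⟨t', ht', -, h2', h3'⟩ := hK.of_isInscribed hE' hab'
    rw [sqrt_one_sub_le_sqrt_one_sub_iff hab.1 hab.2.1 hab'.1 hab'.2.1, h2, h3, h2', h3']
    rw [← sub_nonneg]
    have hg' := kiteSemiaxisSq_pos hp hq ht'
    have ht0' := ht'.1
    have ht0 := ht.1
    -- the arithmetic–geometric mean inequality for `t' * ‖u‖ ^ 2` and `g * ‖v‖ ^ 2`, which is an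
    -- equality for the balanced parameter `t`
    have key : (t' * ‖u‖ ^ 2 + kiteSemiaxisSq p q t' * ‖v‖ ^ 2) ^ 2 *
          (t * kiteSemiaxisSq p q t * (‖u‖ ^ 2 * ‖v‖ ^ 2 - inner ℝ u v ^ 2)) -
        (t * ‖u‖ ^ 2 + kiteSemiaxisSq p q t * ‖v‖ ^ 2) ^ 2 *
          (t' * kiteSemiaxisSq p q t' * (‖u‖ ^ 2 * ‖v‖ ^ 2 - inner ℝ u v ^ 2)) =
        (t' * ‖u‖ ^ 2 - kiteSemiaxisSq p q t' * ‖v‖ ^ 2) ^ 2 *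
          (t * kiteSemiaxisSq p q t * (‖u‖ ^ 2 * ‖v‖ ^ 2 - inner ℝ u v ^ 2)) := by
      linear_combination (-(t' * kiteSemiaxisSq p q t' *
        (‖u‖ ^ 2 * ‖v‖ ^ 2 - inner ℝ u v ^ 2)) *
        (t * ‖u‖ ^ 2 - kiteSemiaxisSq p q t * ‖v‖ ^ 2)) * hbal
    rw [key]
    positivity
  · rintro E ⟨hE, hmin⟩
    obtain ⟨c, a, b, hab⟩ := hE.1
    obtain ⟨c', a', b', hab'⟩ := hins.1
    have hle := hmin E₀ hins _ _ ⟨c, a, b, hab, rfl⟩ ⟨c', a', b', hab', rfl⟩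
    obtain ⟨h2', h3'⟩ := param hab'
    obtain ⟨t', ht', hmem', h2, h3⟩ := hK.of_isInscribed hE hab
    rw [sqrt_one_sub_le_sqrt_one_sub_iff hab.1 hab.2.1 hab'.1 hab'.2.1, h2, h3, h2', h3'] at hle
    have ht0 := ht.1
    have key : (t' * ‖u‖ ^ 2 - kiteSemiaxisSq p q t' * ‖v‖ ^ 2) ^ 2 *
          (t * kiteSemiaxisSq p q t * (‖u‖ ^ 2 * ‖v‖ ^ 2 - inner ℝ u v ^ 2)) ≤ 0 := by
      refine le_of_eq_of_le ?_ (sub_nonpos.2 hle)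
      linear_combination (t' * kiteSemiaxisSq p q t' *
        (‖u‖ ^ 2 * ‖v‖ ^ 2 - inner ℝ u v ^ 2) *
        (t * ‖u‖ ^ 2 - kiteSemiaxisSq p q t * ‖v‖ ^ 2)) * hbal
    have hbal' : t' * ‖u‖ ^ 2 = kiteSemiaxisSq p q t' * ‖v‖ ^ 2 := by
      by_contra hne
      have := sub_ne_zero.2 hne
      have : 0 < (t' * ‖u‖ ^ 2 - kiteSemiaxisSq p q t' * ‖v‖ ^ 2) ^ 2 *
          (t * kiteSemiaxisSq p q t * (‖u‖ ^ 2 * ‖v‖ ^ 2 - inner ℝ u v ^ 2)) := by positivity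
      linarith
    obtain rfl := eq_of_mul_eq_kiteSemiaxisSq_mul hp hq hu hv ht ht' hbal hbal'
    exact ext_of hmem'

/-! ### Conjugate diameters along the diagonals -/

/-- A diameter is determined by its direction. -/
theorem IsDiameter.eq_segment {c u v X Y : Plane} {l : Set Plane} {r : ℝ}
    (h : LinearIndependent ℝ ![u, v]) (hl : IsDiameter (obliqueCircle c u v) l)
    (hXY : Y - X = r • u) (hpar : affineSpan ℝ l ∥ line[ℝ, X, Y]) :
    l = segment ℝ (c - u) (c + u) := by
  obtain ⟨c', P, P', hc', ⟨α, β, hαβ, rfl⟩, -, hmid, rfl⟩ := hl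
  obtain rfl := HasCenter.eq_of_obliqueCircle h hc'
  have hP' : P' = c' - (α • u + β • v) := by
    have : (2 : ℝ) • midpoint ℝ (c' + (α • u + β • v)) P' = (2 : ℝ) • c' := by rw [hmid]
    rw [midpoint_eq_smul_add] at this
    simp only [invOf_eq_inv, smul_smul, ne_eq, OfNat.ofNat_ne_zero, not_false_eq_true,
      mul_inv_cancel₀, one_smul] at this
    rw [eq_sub_of_add_eq' this]
    module
  subst hP'
  have hne : c' + (α • u + β • v) ≠ c' - (α • u + β • v) := by
    intro e
    have e2 : (2 * α) • u + (2 * β) • v = (0 : ℝ) • u + (0 : ℝ) • v := by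
      rw [← sub_eq_zero] at e ⊢
      rw [← e]; module
    obtain ⟨h1, h2⟩ := pair_coords_inj h e2
    nlinarith
  rw [affineSpan_segment_eq_line, line_parallel_iff hne, hXY] at hpar
  obtain ⟨k, hk⟩ := hpar
  have e2 : (-2 * α) • u + (-2 * β) • v = (k * r) • u + (0 : ℝ) • v := by
    have e3 : (k * r) • u + (0 : ℝ) • v = k • r • u := by module
    rw [e3, ← hk]; module
  have hβ : β = 0 := by linarith [(pair_coords_inj h e2).2]
  subst hβ
  have : α = 1 ∨ α = -1 := sq_eq_sq_iff_eq_or_eq_neg.1 (by linarith)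
  rcases this with rfl | rfl
  · rw [segment_symm]; simp
  · simp [sub_eq_add_neg]

theorem isDiameter_obliqueCircle {c u v : Plane} (h : HasCenter (obliqueCircle c u v) c) :
    IsDiameter (obliqueCircle c u v) (segment ℝ (c - u) (c + u)) :=
  ⟨c, _, _, h, ⟨-1, 0, by norm_num, by module⟩, ⟨1, 0, by norm_num, by module⟩,
    by rw [midpoint_eq_smul_add, invOf_eq_inv]; module, rfl⟩

theorem areConjugateDiameters_obliqueCircle {c u v : Plane} (h : LinearIndependent ℝ ![u, v])
    (hc : HasCenter (obliqueCircle c u v) c) :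
    AreConjugateDiameters (obliqueCircle c u v) (segment ℝ (c - u) (c + u))
      (segment ℝ (c - v) (c + v)) := by
  refine ⟨isDiameter_obliqueCircle hc, ?_, ?_⟩
  · rw [obliqueCircle_swap] at hc ⊢
    exact isDiameter_obliqueCircle hc
  · rintro _ ⟨α, β, h1, rfl⟩ _ ⟨α', β', h1', rfl⟩ hne hpar
    rw [affineSpan_segment_eq_line, line_parallel_iff hne] at hpar
    obtain ⟨k, hk⟩ := hpar
    have e : (α' - α) • u + (β' - β) • v = (2 * k) • u + (0 : ℝ) • v := by
      have e1 : (2 * k) • u + (0 : ℝ) • v = k • (c + u - (c - u)) := by module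
      rw [e1, ← hk]; module
    obtain rfl : β' = β := by linarith [(pair_coords_inj h e).2]
    have hα : α' = -α := by
      have : (α' - α) * (α' + α) = 0 := by linear_combination h1' - h1
      rcases mul_eq_zero.1 this with h2 | h2
      · exact absurd (by rw [sub_eq_zero.1 h2]) hne
      · linarith
    subst hα
    rw [segment_eq_image_lineMap]
    have hβ : |β'| ≤ 1 := abs_le_one_iff_mul_self_le_one.2 (by nlinarith [sq_nonneg α])
    rw [abs_le] at hβ
    refine ⟨(1 + β') / 2, ⟨by linarith, by linarith⟩, ?_⟩
    rw [midpoint_eq_smul_add, invOf_eq_inv, AffineMap.lineMap_apply_module']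
    module

theorem areConjugateDiametersParallelToDiagonals_iff {c u v : Plane} {A : Fin 4 → Plane}
    {r s : ℝ} (h : LinearIndependent ℝ ![u, v]) (huv : ‖u‖ = ‖v‖) (hr : r ≠ 0) (hs : s ≠ 0)
    (h02 : A 2 - A 0 = r • u) (h13 : A 3 - A 1 = s • v) {l m : Set Plane} :
    AreConjugateDiametersParallelToDiagonals (obliqueCircle c u v) A l m ↔
      l = segment ℝ (c - u) (c + u) ∧ m = segment ℝ (c - v) (c + v) := by
  have hu : c - u ≠ c + u := by
    intro e
    have : (2 : ℝ) • u = 0 := by rw [← sub_eq_zero.2 e.symm]; module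
    exact h.ne_zero 0 (by simpa using this)
  have hv : c - v ≠ c + v := by
    intro e
    have : (2 : ℝ) • v = 0 := by rw [← sub_eq_zero.2 e.symm]; module
    exact h.ne_zero 1 (by simpa using this)
  constructor
  · rintro ⟨⟨hl, hm, -⟩, pl, pm⟩
    refine ⟨hl.eq_segment h h02 pl, ?_⟩
    rw [obliqueCircle_swap] at hm
    exact hm.eq_segment (linearIndependent_pair_swap h) h13 pm
  · rintro ⟨rfl, rfl⟩
    refine ⟨areConjugateDiameters_obliqueCircle h (isEllipse_obliqueCircle h huv), ?_, ?_⟩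
    · rw [affineSpan_segment_eq_line, line_parallel_iff hu]
      refine ⟨2 / r, ?_⟩
      rw [h02, smul_smul, div_mul_cancel₀ _ hr]; module
    · rw [affineSpan_segment_eq_line, line_parallel_iff hv]
      refine ⟨2 / s, ?_⟩
      rw [h13, smul_smul, div_mul_cancel₀ _ hs]; module

theorem existsUnique_conjugateDiameters_of_minimal {c u v : Plane} {A : Fin 4 → Plane} {r s : ℝ}
    (h : LinearIndependent ℝ ![u, v]) (huv : ‖u‖ = ‖v‖) (hr : r ≠ 0) (hs : s ≠ 0)
    (h02 : A 2 - A 0 = r • u) (h13 : A 3 - A 1 = s • v)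
    (hmin : IsMinimalEccentricityInscribed (obliqueCircle c u v) A)
    (huniq : ∀ E, IsMinimalEccentricityInscribed E A → E = obliqueCircle c u v) :
    (∃! E : Set Plane, IsMinimalEccentricityInscribed E A) ∧
    ∀ E : Set Plane, IsMinimalEccentricityInscribed E A →
      (∃! p : Set Plane × Set Plane, AreConjugateDiametersParallelToDiagonals E A p.1 p.2) ∧
      ∀ l m : Set Plane, AreConjugateDiametersParallelToDiagonals E A l m →
        AreEqualConjugateDiameters E l m := by
  have key := @areConjugateDiametersParallelToDiagonals_iff c u v A r s h huv hr hs h02 h13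
  refine ⟨⟨_, hmin, huniq⟩, fun E hE => ?_⟩
  rw [huniq E hE]
  refine ⟨⟨(_, _), key.2 ⟨rfl, rfl⟩, ?_⟩, ?_⟩
  · rintro ⟨l, m⟩ hlm
    exact Prod.ext (key.1 hlm).1 (key.1 hlm).2
  · intro l m hlm
    refine ⟨hlm.1, ?_⟩
    obtain ⟨rfl, rfl⟩ := key.1 hlm
    rw [diam_segment_eq_dist, diam_segment_eq_dist, dist_eq_norm, dist_eq_norm]
    have e : ∀ w : Plane, c - w - (c + w) = (-2 : ℝ) • w := fun w => by module
    rw [e, e, norm_smul, norm_smul, huv]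

/-! ### Midpoint diagonal quadrilaterals are affine kites -/

/-- A convex quadrilateral whose diagonal `A 0 A 2` is bisected by the other one is an affine kite. The
frame vectors are half of the bisected diagonal and the whole of the other one. -/
theorem IsConvexQuadrilateral.isKite (hA : IsConvexQuadrilateral A) {P : Plane}
    (hP : P ∈ segment ℝ (A 1) (A 3)) (hmid : P = midpoint ℝ (A 0) (A 2)) :
    ∃ (u v : Plane) (p q : ℝ), IsKite A P u v p q := by
  obtain ⟨s, ⟨hs0, hs1⟩, hs⟩ := (segment_eq_image_lineMap ℝ (A 1) (A 3)) ▸ hP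
  have hmem : P ∈ line[ℝ, A 0, A 2] := hmid ▸ AffineMap.lineMap_mem_affineSpan_pair _ _ _
  rw [AffineMap.lineMap_apply_module'] at hs
  rw [midpoint_eq_smul_add, invOf_eq_inv] at hmid
  have e0 : A 0 = P + ((-1 : ℝ) • (A 2 - P) + (0 : ℝ) • (A 1 - A 3)) := by
    rw [hmid]; module
  have e1 : A 1 = P + ((0 : ℝ) • (A 2 - P) + s • (A 1 - A 3)) := by
    rw [← hs]; module
  have e3 : A 3 = P + ((0 : ℝ) • (A 2 - P) + (-(1 - s)) • (A 1 - A 3)) := by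
    rw [← hs]; module
  have ne1 : A 1 ≠ P := by
    intro e
    refine hA.1 1 0 2 (by decide) (by decide) (by decide) ?_
    exact collinear_insert_of_mem_affineSpan_pair (e ▸ hmem)
  have ne3 : A 3 ≠ P := by
    intro e
    refine hA.1 3 0 2 (by decide) (by decide) (by decide) ?_
    exact collinear_insert_of_mem_affineSpan_pair (e ▸ hmem)
  have hs0' : s ≠ 0 := by
    rintro rfl
    exact ne1 (e1.trans (by simp))
  have hs1' : s ≠ 1 := by
    rintro rfl
    exact ne3 (e3.trans (by simp))
  refine ⟨A 2 - P, A 1 - A 3, s, 1 - s, ?_, lt_of_le_of_ne hs0 hs0'.symm,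
    sub_pos.2 (lt_of_le_of_ne hs1 hs1'), e0, e1, by module, e3⟩
  have hu : A 2 - P ≠ 0 := by
    intro e
    refine hA.1 1 0 2 (by decide) (by decide) (by decide) ?_
    have e02 : A 0 = A 2 := by
      rw [e] at e0
      rw [sub_eq_zero.1 e]
      exact e0.trans (by simp)
    rw [e02, Set.pair_eq_singleton]
    exact collinear_pair ℝ _ _
  rw [LinearIndependent.pair_iff' hu]
  intro a ha
  refine hA.1 1 0 2 (by decide) (by decide) (by decide) ?_
  apply collinear_insert_of_mem_affineSpan_pair
  rw [mem_affineSpan_pair_iff_exists_lineMap_eq]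
  refine ⟨(1 + s * a) / 2, ?_⟩
  rw [AffineMap.lineMap_apply_module', e1, ← ha]
  rw [hmid]
  module

theorem theorem4 (A : Fin 4 → Plane) (hA : IsMidpointDiagonalQuadrilateral A) :
    (∃! E : Set Plane, IsMinimalEccentricityInscribed E A) ∧
    ∀ E : Set Plane, IsMinimalEccentricityInscribed E A →
      (∃! p : Set Plane × Set Plane, AreConjugateDiametersParallelToDiagonals E A p.1 p.2) ∧
      ∀ l m : Set Plane, AreConjugateDiametersParallelToDiagonals E A l m →
        AreEqualConjugateDiameters E l m := by
  obtain ⟨hconv, P, hP, hmid | hmid⟩ := hA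
  · obtain ⟨u, v, p, q, hK⟩ := hconv.isKite hP.2 hmid
    obtain ⟨c, r, s, hr, hs, hn, hmin, huniq⟩ := hK.exists_minimal
    have hp := hK.p_pos
    have hq := hK.q_pos
    refine existsUnique_conjugateDiameters_of_minimal (r := 2 / r) (s := -(p + q) / s)
      (linearIndependent_smul_pair hK.li hr.ne' hs.ne') hn (by positivity) ?_ ?_ ?_ hmin huniq
    · exact div_ne_zero (by linarith) hs.ne'
    · rw [hK.vertex_two, hK.vertex_zero, smul_smul, div_mul_cancel₀ _ hr.ne']; module
    · rw [hK.vertex_three, hK.vertex_one, smul_smul, div_mul_cancel₀ _ hs.ne']; module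
  -- if the other diagonal is bisected, shift the labels of the vertices by one
  · have hconv' : IsConvexQuadrilateral (fun i => A (i + 1)) := by
      refine ⟨fun i j k hij hjk hik => hconv.1 _ _ _ (by simpa) (by simpa) (by simpa), P, hP.2, ?_⟩
      rw [segment_symm]
      exact hP.1
    have hins : ∀ E, IsInscribed E (fun i => A (i + 1)) ↔ IsInscribed E A := by
      intro E
      have hrange : Set.range (fun i => A (i + 1)) = Set.range A :=
        (Equiv.addRight (1 : Fin 4)).surjective.range_comp A
      unfold IsInscribed
      rw [hrange, (Equiv.addRight (1 : Fin 4)).forall_congr_left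
        (p := fun i => IsTangentToSide E (A (i + 1)) (A (i + 1 + 1)))]
      simp
    have hmin' : ∀ E, IsMinimalEccentricityInscribed E (fun i => A (i + 1)) ↔
        IsMinimalEccentricityInscribed E A := by
      intro E
      simp only [IsMinimalEccentricityInscribed, hins]
    obtain ⟨u, v, p, q, hK⟩ := hconv'.isKite (P := P) (by rw [segment_symm]; exact hP.1) hmid
    obtain ⟨c, r, s, hr, hs, hn, hmin, huniq⟩ := hK.exists_minimal
    simp only [hmin'] at hmin huniq
    have hp := hK.p_pos
    have hq := hK.q_pos
    rw [obliqueCircle_swap] at hmin huniq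
    have e0 : A 1 = _ := hK.vertex_zero
    have e1 : A 2 = _ := hK.vertex_one
    have e2 : A 3 = _ := hK.vertex_two
    have e3 : A 0 = _ := hK.vertex_three
    refine existsUnique_conjugateDiameters_of_minimal (r := (p + q) / s) (s := 2 / r)
      (linearIndependent_pair_swap (linearIndependent_smul_pair hK.li hr.ne' hs.ne')) hn.symm
      (by positivity) (by positivity) ?_ ?_ hmin huniq
    · rw [e1, e3, smul_smul, div_mul_cancel₀ _ hs.ne']; module
    · rw [e2, e0, smul_smul, div_mul_cancel₀ _ hr.ne']; module
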